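/- **Setting.** Let $n,k,d,r,e,f$ be natural numbers with $n\ge 1$, $r\mid n$, $k\le n$, $f\ge 1$, $f\mid e$ and $e/f\le n/r$; put $m=\lfloor kr/n\rfloor$ and assume $m\le d\le r-f$ and $f\mid m$. There are $n$ nodes in $r$ racks of $n/r$ nodes, and the first node of each rack is its *relayer*. A *failure pattern* consists of a set $F$ of $f$ racks, a set of $e/f$ failed nodes in each rack of $F$, and a set $H$ of $d$ helper racks, disjoint from $F$. A *rack-aware cooperative storage system* (RCSS) with parameters $n,k,d,r,e,f,\alpha,\beta_1,\beta_2$ and file size $B$ (natural numbers), over a finite alphabet $A$ with at least two symbols, is a nonempty set of states; a state assigns to each node a function from files in $A^B$ to contents in $A^\alpha$. In every state the file can be recovered from any $k$ nodes (where a contacted relayer gives access to its whole rack). For every state and every failure pattern there is a state of the system that results from the following functional repair: non-failed nodes are unchanged; first, every helper rack sends $\beta_1$ symbols, computed from its contents, to every rack in $F$; then every rack in $F$ sends $\beta_2$ symbols, computed from its surviving nodes and from what it received in the first round, to every other rack in $F$; finally the failed nodes of each rack in $F$ are refilled as functions of the surviving nodes of the rack and of what it received in both rounds. An *information flow graph*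 with real capacities $\alpha,\beta_1,\beta_2\ge 0$ is given by a finite sequence of failure patterns (stages). It has a source $S$, a vertex $\mathrm{Out}_{h,i}$ for each node, and an edge $S\to\mathrm{Out}_{h,i}$ of capacity $\alpha$. For each stage and each rack $h\in F$ it has new vertices $\mathrm{virt}_h$, $\mathrm{mid}_h$ and $\mathrm{Out}'_{h,i}$ ($\mathrm{Out}'_{h,i}$ replacing the current $\mathrm{Out}_{h,i}$), with edges: from the current relayer of each helper rack to $\mathrm{virt}_h$ (capacity $\beta_1$); from $\mathrm{Out}_{h,i}$ to $\mathrm{virt}_h$ (capacity $\alpha$) and to $\mathrm{Out}'_{h,i}$ (capacity $\infty$) for each surviving $i$; $\mathrm{virt}_h\to\mathrm{mid}_h$ (capacity $\infty$); $\mathrm{virt}_h\to\mathrm{mid}_{h'}$ (capacity $\beta_2$) for $h'\in F$, $h'\ne h$; $\mathrm{mid}_h\to\mathrm{Out}'_{h,i}$ (capacity $\alpha$) for each failed $i$. In every version of a rack there are edges of infinite capacity from the other nodes to the relayer. A data collector $T$ is joined by edges of infinite capacity from the current versions of $k$ nodes. **Theorem.** Let $g\in\mathbb N$ and let $u=(u_1,\dots,u_g)$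 be natural numbers with $1\le u_i\le f$ and $\sum_{i=1}^g u_i=m$. Put $$R_u(\alpha,\beta_1,\beta_2)=k\alpha+\sum_{i=1}^{g}u_i\,\min\Bigl(0,\ \bigl(d-\sum_{j<i}u_j\bigr)\beta_1-\frac ef\,\alpha+(f-u_i)\beta_2\Bigr).$$ 1. If an RCSS with parameters $n,k,d,r,e,f,\alpha,\beta_1,\beta_2$ and file size $B$ exists, then $B\le R_u(\alpha,\beta_1,\beta_2)$. 2. For all real $\alpha,\beta_1,\beta_2\ge0$ there are an information flow graph, a data collector $T$ and an $(S,T)$-cut whose capacity is exactly $R_u(\alpha,\beta_1,\beta_2)$. -/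

import Mathlib

open scoped ENNReal NNReal

namespace RackCoop

/-- One round of failures and repair.  There are `n` nodes, arranged in `r` racks of `n / r` nodes;
node `i` of rack `h` is the pair `(h, i)` and the node with index `0` is the relayer of its rack.
In each of `f` racks, `e / f` nodes fail; `d` racks without failures are the helper racks. -/
structure FailurePattern (n d r e f : ℕ) where
  /-- the racks that contain failed nodes (the repair group) -/
  racks : Finset (Fin r)
  card_racks : racks.card = f
  /-- the failed nodes of each rack of the repair group (not used for other racks) -/
  failed : Fin r → Finset (Fin (n / r))
  card_failed : ∀ h ∈ racks, (failed h).card = e / f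
  /-- the helper racks -/
  helpers : Finset (Fin r)
  card_helpers : helpers.card = d
  disjoint_helpers : Disjoint helpers racks

/-! ### Storage systems -/

/-- A state of the system: for each node, the function that maps the file (`B` symbols
of the alphabet `A`) to the content of the node (`α` symbols). -/
abbrev State (A : Type*) (n r α B : ℕ) : Type _ :=
  Fin r → Fin (n / r) → (Fin B → A) → (Fin α → A)

/-- The nodes whose content is available to somebody who contacts the nodes of `K`: the nodes
of `K` and, for each relayer in `K`, all the nodes of its rack. -/
def accessible {n r : ℕ} (K : Finset (Fin r × Fin (n / r))) : Set (Fin r × Fin (n / r)) :=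
  {v | v ∈ K ∨ ∃ i : Fin (n / r), i.val = 0 ∧ (v.1, i) ∈ K}

/-- The file can be recovered from the nodes in `K`. -/
def Reconstructs {A : Type*} {n r α B : ℕ} (c : State A n r α B)
    (K : Finset (Fin r × Fin (n / r))) : Prop :=
  ∃ decode : (accessible K → Fin α → A) → (Fin B → A),
    ∀ x : Fin B → A, decode (fun v => c v.1.1 v.1.2 x) = x

/-- The state `c'` can result from the state `c` by a two-round repair of the failures `p`.
Nodes that did not fail keep their content.  In the first round each helper rack `j` sends
`β₁` symbols, computed from the contents of all its nodes, to each rack `h` of the repair group.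
In the second round each rack `h` of the repair group sends `β₂` symbols to each other
rack `h'` of the group, computed from its surviving nodes and from what it received in the first
round.  The new contents of the failed nodes of a rack are computed from its surviving nodes
and from what the rack received in both rounds. -/
def Repairs {A : Type*} {n d r e f α B : ℕ} (β₁ β₂ : ℕ) (c : State A n r α B)
    (p : FailurePattern n d r e f) (c' : State A n r α B) : Prop :=
  (∀ h i, ¬ (h ∈ p.racks ∧ i ∈ p.failed h) → c' h i = c h i) ∧
  ∃ (first : (j h : Fin r) → (Fin (n / r) → Fin α → A) → (Fin β₁ → A))
    (second : (h h' : Fin r) → ({i // i ∉ p.failed h} → Fin α → A) →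
      ({j // j ∈ p.helpers} → Fin β₁ → A) → (Fin β₂ → A))
    (rebuild : (h : Fin r) → ({i // i ∉ p.failed h} → Fin α → A) →
      ({j // j ∈ p.helpers} → Fin β₁ → A) →
      ({h' // h' ∈ p.racks ∧ h' ≠ h} → Fin β₂ → A) → Fin (n / r) → (Fin α → A)),
    ∀ x : Fin B → A,
      let surviving (h : Fin r) : {i // i ∉ p.failed h} → Fin α → A := fun i => c h i.1 x
      let received (h : Fin r) : {j // j ∈ p.helpers} → Fin β₁ → A :=
        fun j => first j.1 h (fun i => c j.1 i x)
      ∀ h ∈ p.racks, ∀ i ∈ p.failed h,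
        c' h i x = rebuild h (surviving h) (received h)
          (fun h' => second h'.1 h (surviving h'.1) (received h'.1)) i

/-- A rack-aware cooperative storage system over the alphabet `A`, with file size `B`.
Repair is functional: the content of a repaired node may differ from the lost one, as long as the
system can go on.  So the system is a set of states, in each of which any `k` nodes suffice to
recover the file, and each pattern of failures can be repaired so that the new state is again
one of them. -/
structure RCSS (A : Type*) (n k d r e f α β₁ β₂ B : ℕ) where
  states : Set (State A n r α B)
  nonempty : states.Nonempty
  reconstruction : ∀ c ∈ states, ∀ K : Finset (Fin r × Fin (n / r)), K.card = k →
    Reconstructs c K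
  regeneration : ∀ c ∈ states, ∀ p : FailurePattern n d r e f,
    ∃ c' ∈ states, Repairs β₁ β₂ c p c'

/-! ### Information flow graphs -/

/-- An information flow graph is determined by its sequence of failure patterns. -/
structure IFG (n d r e f : ℕ) where
  numStages : ℕ
  pattern : Fin numStages → FailurePattern n d r e f

/-- The vertices of an information flow graph with `g` stages and racks of `N` nodes.
`out 0 h i` is node `(h, i)` as it is at the beginning; `virt s h`, `mid s h` and
`out (s + 1) h i` are the vertices that belong to the repair of rack `h` in stage `s`
(no edge is incident with them when rack `h` is not repaired in stage `s`). -/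
inductive Vertex (g r N : ℕ) : Type
  | source : Vertex g r N
  | out (v : Fin (g + 1)) (h : Fin r) (i : Fin N) : Vertex g r N
  | virt (s : Fin g) (h : Fin r) : Vertex g r N
  | mid (s : Fin g) (h : Fin r) : Vertex g r N
  | sink : Vertex g r N
  deriving DecidableEq, Fintype

namespace IFG

variable {n d r e f : ℕ}

/-- Rack `h` is repaired in stage `s`. -/
def RepairedIn (G : IFG n d r e f) (s : ℕ) (h : Fin r) : Prop :=
  ∃ hs : s < G.numStages, h ∈ (G.pattern ⟨s, hs⟩).racks

/-- The version of rack `h` that exists after the stages `0, …, t - 1`: it is `0` if the rack has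
not been repaired yet, and `s + 1` if its last repair was in stage `s`. -/
noncomputable def version (G : IFG n d r e f) (h : Fin r) : ℕ → ℕ
  | 0 => 0
  | t + 1 => open Classical in if G.RepairedIn t h then t + 1 else G.version h t

/-- Version `v` of rack `h` occurs in the graph. -/
def IsVersion (G : IFG n d r e f) (v : ℕ) (h : Fin r) : Prop :=
  v = 0 ∨ ∃ s, v = s + 1 ∧ G.RepairedIn s h

open Classical in
/-- The capacity of the edge from `x` to `y` (`0` if there is no edge), when the data collector,
`sink`, is connected to the nodes in `K`. -/
noncomputable def cap (G : IFG n d r e f) (α β₁ β₂ : ℝ≥0) (K : Finset (Fin r × Fin (n / r)))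
    (x y : Vertex G.numStages r (n / r)) : ℝ≥0∞ :=
  match x, y with
  | .source, .out v _ _ => if v.val = 0 then (α : ℝ≥0∞) else 0
  | .out v h i, .out w h' j =>
      -- from the other nodes of a rack to its relayer
      if h = h' ∧ v = w ∧ G.IsVersion v h ∧ i.val ≠ 0 ∧ j.val = 0 then ⊤
      -- nodes that survive in a rack that is repaired
      else if h = h' ∧ i = j ∧ ∃ s : Fin G.numStages, w.val = s.val + 1 ∧
          v.val = G.version h s ∧ h ∈ (G.pattern s).racks ∧ i ∉ (G.pattern s).failed h then ⊤
      else 0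
  | .out v h i, .virt s h' =>
      if h' ∈ (G.pattern s).racks ∧ v.val = G.version h s then
        if h = h' then (if i ∉ (G.pattern s).failed h then (α : ℝ≥0∞) else 0)
        else if h ∈ (G.pattern s).helpers ∧ i.val = 0 then (β₁ : ℝ≥0∞) else 0
      else 0
  | .virt s h, .mid s' h' =>
      if s = s' ∧ h ∈ (G.pattern s).racks ∧ h' ∈ (G.pattern s).racks then
        (if h = h' then ⊤ else (β₂ : ℝ≥0∞))
      else 0
  | .mid s h, .out v h' i =>
      if h = h' ∧ v.val = s.val + 1 ∧ h ∈ (G.pattern s).racks ∧ i ∈ (G.pattern s).failed h then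
        (α : ℝ≥0∞)
      else 0
  | .out v h i, .sink => if (h, i) ∈ K ∧ v.val = G.version h G.numStages then ⊤ else 0
  | _, _ => 0

/-- The capacity of the cut that separates the vertices in `W` from those outside `W`: the sum of
the capacities of the edges that enter `W`. -/
noncomputable def cutCapacity (G : IFG n d r e f) (α β₁ β₂ : ℝ≥0)
    (K : Finset (Fin r × Fin (n / r))) (W : Finset (Vertex G.numStages r (n / r))) : ℝ≥0∞ :=
  ∑ x ∈ Wᶜ, ∑ y ∈ W, G.cap α β₁ β₂ K x y

end IFG

/-- The right-hand side
`k α + ∑ i, u i * min (0, (d - ∑ j < i, u j) β₁ - (e / f) α + (f - u i) β₂)` of the bound. -/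
noncomputable def fileSizeBound (k d e f : ℕ) (α β₁ β₂ : ℝ) {g : ℕ} (u : Fin g → ℕ) : ℝ :=
  (k : ℝ) * α + ∑ i : Fin g, (u i : ℝ) *
    min 0 (((d : ℝ) - ∑ j ∈ Finset.Iio i, (u j : ℝ)) * β₁ - ((e : ℝ) / (f : ℝ)) * α
      + ((f : ℝ) - (u i : ℝ)) * β₂)

end RackCoop

/-! ### Choice of the failure patterns -/

namespace RackCoop

/-! Write `N = n / r`, so that `m = k / N` and `k = m * N + k % N`. Both parts use the same sequence
of repairs and the same set of `k` nodes: disjoint groups of `u i` core racks, `m` racks in all,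
each repaired exactly once, with all earlier groups among its helpers, and `k % N` non-relayer nodes
of a further rack.

A core rack of stage `i` has `N - e / f` survivors. Its lost part costs the smaller of two amounts:
the lost contents themselves, `(e / f) * α`, or the messages that the rack receives. Among the
latter, those from earlier core racks and from core racks of the same stage are free, since they are
computed from data already known; the other `d - ∑ j < i, u j` helpers and `f - u i` racks of the
repair group have to be paid for. Adding up gives the bound (`fileSizeBound_eq`).

For storage systems the costs count symbols that determine the file, and an injection between powers
of `A` yields the inequality (`Arrangement.describedBy_stage`, `Arrangement.file_size_le`). For flow
graphs they are capacities of the edges entering an explicit set, where `op` selects the stages in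
which the messages are strictly cheaper (`Arrangement.cutCapacity_sinkSide`). -/

/-- A sequence of failure patterns in which the racks of the sets `core i` are repaired only in
stage `i`, with the help of all the racks of earlier core sets; the rack `spare` is never repaired.
In all the racks the failed nodes have the same indices, and the relayer is among them, unless no
node fails at all. -/
structure Arrangement (n d r e f : ℕ) {g : ℕ} (u : Fin g → ℕ) where
  pattern : Fin g → FailurePattern n d r e f
  core : Fin g → Finset (Fin r)
  spare : Fin r
  lost : Finset (Fin (n / r))
  card_core : ∀ i, (core i).card = u i
  core_subset : ∀ i, core i ⊆ (pattern i).racks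
  disjoint_racks : ∀ i j, i ≠ j → Disjoint (core i) (pattern j).racks
  core_subset_helpers : ∀ i j, j < i → core j ⊆ (pattern i).helpers
  spare_notMem_core : ∀ i, spare ∉ core i
  spare_notMem : ∀ i, spare ∉ (pattern i).racks
  failed_eq : ∀ i h, (pattern i).failed h = lost
  card_lost : lost.card = e / f
  relayer_lost : lost.Nonempty → ∀ j : Fin (n / r), j.val = 0 → j ∈ lost

theorem Arrangement.nonempty {n d r e f g : ℕ} {u : Fin g → ℕ} (hef : e / f ≤ n / r)
    (hu : ∀ i, 1 ≤ u i ∧ u i ≤ f) (hd : ∑ i, u i ≤ d) (hdr : d + f ≤ r) (hf : 0 < f) :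
    Nonempty (Arrangement n d r e f u) := by
  classical
  -- `none` becomes the spare rack. There is room for it because `∑ i, u i + 1 ≤ d + f ≤ r`.
  obtain ⟨ι⟩ : Nonempty (Option (Σ i, Fin (u i)) ↪ Fin r) := by
    apply Function.Embedding.nonempty_of_card_le
    simp only [Fintype.card_option, Fintype.card_sigma, Fintype.card_fin]
    omega
  let core : Fin g → Finset (Fin r) := fun i => Finset.univ.image fun j => ι (some ⟨i, j⟩)
  have card_core : ∀ i, (core i).card = u i := fun i => by
    rw [Finset.card_image_of_injective _ (fun a b h => by simpa using h)]
    simp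
  have hdisj : ∀ i j, i ≠ j → Disjoint (core i) (core j) := by
    intro i j hij
    rw [Finset.disjoint_left]
    simp only [core, Finset.mem_image, Finset.mem_univ, true_and]
    rintro _ ⟨a, rfl⟩ ⟨b, hb⟩
    have := ι.injective hb
    simp only [Option.some.injEq, Sigma.mk.injEq] at this
    exact hij this.1.symm
  let spare := ι none
  have hspare : ∀ i, spare ∉ core i := by
    intro i
    simp [core, spare]
  have card_others : ∀ s : Finset (Fin g), (s.biUnion core).card = ∑ i ∈ s, u i := fun s => by
    rw [Finset.card_biUnion fun i _ j _ h => hdisj i j h]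
    exact Finset.sum_congr rfl fun i _ => card_core i
  have hracks : ∀ i, ∃ F : Finset (Fin r), core i ⊆ F ∧
      F ⊆ (insert spare ((Finset.univ.erase i).biUnion core))ᶜ ∧ F.card = f := by
    intro i
    apply Finset.exists_subsuperset_card_eq
    · intro h hh
      simp only [Finset.mem_compl, Finset.mem_insert, Finset.mem_biUnion, Finset.mem_erase,
        Finset.mem_univ, and_true, not_or, not_exists, not_and]
      exact ⟨fun e => hspare i (e ▸ hh), fun j hj hj' =>
        Finset.disjoint_left.1 (hdisj i j hj.symm) hh hj'⟩
    · rw [card_core]; exact (hu i).2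
    -- At least `r - (1 + ∑ i, u i - u i)` racks are allowed, where the subtracted `u i` is that of
    -- this stage. As `u i ≥ 1` pays for the spare rack, this is at least `r - d ≥ f`.
    · rw [Finset.card_compl, Fintype.card_fin]
      have h1 := Finset.card_insert_le spare ((Finset.univ.erase i).biUnion core)
      rw [card_others] at h1
      have h2 := Finset.add_sum_erase Finset.univ u (Finset.mem_univ i)
      have := (hu i).1
      omega
  choose F hF1 hF2 hF3 using hracks
  have hFcore : ∀ i j, i ≠ j → Disjoint (core i) (F j) := by
    intro i j hij
    rw [Finset.disjoint_left]
    intro h hh hF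
    have := hF2 j hF
    simp only [Finset.mem_compl, Finset.mem_insert, Finset.mem_biUnion, Finset.mem_erase,
        Finset.mem_univ, and_true, not_or, not_exists, not_and] at this
    exact this.2 i hij hh
  have hhelp : ∀ i, ∃ H : Finset (Fin r), (Finset.Iio i).biUnion core ⊆ H ∧ H ⊆ (F i)ᶜ ∧
      H.card = d := by
    intro i
    apply Finset.exists_subsuperset_card_eq
    · intro h hh
      obtain ⟨j, hj, hh⟩ := Finset.mem_biUnion.1 hh
      rw [Finset.mem_compl]
      exact Finset.disjoint_left.1 (hFcore j i (Finset.mem_Iio.1 hj).ne) hh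
    · rw [card_others]
      exact (Finset.sum_le_sum_of_subset (Finset.subset_univ _)).trans hd
    · rw [Finset.card_compl, Fintype.card_fin, hF3]
      omega
  choose H hH1 hH2 hH3 using hhelp
  obtain ⟨lost, hl1, hl2⟩ : ∃ lost : Finset (Fin (n / r)), lost.card = e / f ∧
      (lost.Nonempty → ∀ j : Fin (n / r), j.val = 0 → j ∈ lost) := by
    -- An initial segment of the indices contains the relayer `0` as soon as it is nonempty.
    refine ⟨Finset.univ.filter fun j => j.val < e / f, ?_, ?_⟩
    · rw [Fin.card_filter_val_lt]; omega
    · rintro ⟨a, ha⟩ j hj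
      simp only [Finset.mem_filter, Finset.mem_univ, true_and] at ha ⊢
      omega
  exact ⟨{
    pattern := fun i => ⟨F i, hF3 i, fun _ => lost, fun _ _ => hl1, H i, hH3 i, by
      rw [Finset.disjoint_left]
      intro h hh
      exact Finset.mem_compl.1 (hH2 i hh)⟩
    core := core
    spare := spare
    lost := lost
    card_core := card_core
    core_subset := hF1
    disjoint_racks := hFcore
    core_subset_helpers := fun i j hij h hh =>
      hH1 i (Finset.mem_biUnion.2 ⟨j, Finset.mem_Iio.2 hij, hh⟩)
    spare_notMem_core := hspare
    spare_notMem := fun i hi => by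
      have := hF2 i hi
      simp at this
    failed_eq := fun _ _ => rfl
    card_lost := hl1
    relayer_lost := hl2 }⟩

namespace Arrangement

variable {n d r e f g : ℕ} {u : Fin g → ℕ} (a : Arrangement n d r e f u)

theorem disjoint_core (i j : Fin g) (h : i ≠ j) : Disjoint (a.core i) (a.core j) :=
  (a.disjoint_racks i j h).mono_right (a.core_subset j)

theorem card_earlier (i : Fin g) :
    ((Finset.Iio i).biUnion a.core).card = ∑ j ∈ Finset.Iio i, u j := by
  rw [Finset.card_biUnion fun i _ j _ h => a.disjoint_core i j h]
  exact Finset.sum_congr rfl fun i _ => a.card_core i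

theorem card_new_helpers (i : Fin g) :
    ((a.pattern i).helpers \ (Finset.Iio i).biUnion a.core).card =
      d - ∑ j ∈ Finset.Iio i, u j := by
  rw [Finset.card_sdiff_of_subset, a.card_earlier, (a.pattern i).card_helpers]
  exact Finset.biUnion_subset.2 fun j hj => a.core_subset_helpers i j (Finset.mem_Iio.1 hj)

theorem card_other_racks (i : Fin g) :
    ((a.pattern i).racks \ a.core i).card = f - u i := by
  rw [Finset.card_sdiff_of_subset (a.core_subset i), a.card_core, (a.pattern i).card_racks]

/-- All the nodes of the core racks, and the nodes of the spare rack with index in `I`. -/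
def collector (I : Finset (Fin (n / r))) : Finset (Fin r × Fin (n / r)) :=
  (Finset.univ.biUnion a.core) ×ˢ Finset.univ ∪ {a.spare} ×ˢ I

theorem mem_collector {I : Finset (Fin (n / r))} {h : Fin r} {j : Fin (n / r)} :
    (h, j) ∈ a.collector I ↔ (∃ i, h ∈ a.core i) ∨ (h = a.spare ∧ j ∈ I) := by
  simp [collector, and_comm, eq_comm]

theorem card_collector (I : Finset (Fin (n / r))) :
    (a.collector I).card = (∑ i, u i) * (n / r) + I.card := by
  rw [collector, Finset.card_union_of_disjoint, Finset.card_product, Finset.card_product,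
    Finset.card_biUnion fun i _ j _ h => a.disjoint_core i j h]
  · simp [a.card_core]
  · rw [Finset.disjoint_left]
    rintro ⟨h, j⟩ h1 h2
    simp only [Finset.mem_product, Finset.mem_biUnion, Finset.mem_univ, true_and, and_true,
      Finset.mem_singleton] at h1 h2
    obtain ⟨i, hi⟩ := h1
    exact a.spare_notMem_core i (h2.1 ▸ hi)

end Arrangement

/-! ### Counting symbols that determine a relation -/

/-- Some `c` symbols, computed from `x`, determine `x` up to the relation `P`. -/
def DescribedBy (A : Type*) {X : Type*} (P : X → X → Prop) (c : ℕ) : Prop :=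
  ∃ φ : X → Fin c → A, ∀ x y, φ x = φ y → P x y

namespace DescribedBy

variable {A X : Type*} {P Q : X → X → Prop} {b c : ℕ}

theorem mono (h : DescribedBy A P c) (hPQ : ∀ x y, P x y → Q x y) : DescribedBy A Q c :=
  h.imp fun _ hφ x y hxy => hPQ x y (hφ x y hxy)

theorem of_fun (φ : X → Fin c → A) : DescribedBy A (fun x y => φ x = φ y) c :=
  ⟨φ, fun _ _ => id⟩

theorem and (hP : DescribedBy A P b) (hQ : DescribedBy A Q c) :
    DescribedBy A (fun x y => P x y ∧ Q x y) (b + c) := by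
  obtain ⟨φ, hφ⟩ := hP
  obtain ⟨ψ, hψ⟩ := hQ
  refine ⟨fun x => Fin.append (φ x) (ψ x), fun x y h => ⟨hφ x y ?_, hψ x y ?_⟩⟩
  · funext i
    simpa using congrFun h (Fin.castAdd c i)
  · funext i
    simpa using congrFun h (Fin.natAdd b i)

theorem forall_mem {ι : Type*} (s : Finset ι) {P : ι → X → X → Prop} {c : ι → ℕ}
    (h : ∀ i ∈ s, DescribedBy A (P i) (c i)) :
    DescribedBy A (fun x y => ∀ i ∈ s, P i x y) (∑ i ∈ s, c i) := by
  classical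
  induction s using Finset.induction_on with
  | empty => exact ⟨fun _ i => i.elim0, by simp⟩
  | insert i s hi ih =>
    rw [Finset.sum_insert hi]
    refine ((h i (Finset.mem_insert_self i s)).and
      (ih fun j hj => h j (Finset.mem_insert_of_mem hj))).mono fun x y hxy => ?_
    simpa using hxy

theorem forall_mem_const {ι : Type*} (s : Finset ι) {P : ι → X → X → Prop}
    (h : ∀ i ∈ s, DescribedBy A (P i) c) :
    DescribedBy A (fun x y => ∀ i ∈ s, P i x y) (s.card * c) := by
  simpa using forall_mem s h

theorem le_of_eq [Finite A] [Nontrivial A]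
    (h : DescribedBy A (fun x y : Fin b → A => x = y) c) : b ≤ c := by
  obtain ⟨φ, hφ⟩ := h
  have := Nat.card_le_card_of_injective φ fun x y => hφ x y
  simp only [Nat.card_fun, Nat.card_fin] at this
  exact (Nat.pow_le_pow_iff_right Finite.one_lt_card).1 this

end DescribedBy

/-! ### Upper bound on the file size -/

variable {n k d r e f g : ℕ} {u : Fin g → ℕ}

/-- The number of symbols that suffice to describe a core rack of stage `i`. -/
def coreCost (n d r e f α β₁ β₂ : ℕ) {g : ℕ} (u : Fin g → ℕ) (i : Fin g) : ℕ :=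
  (n / r - e / f) * α +
    min (e / f * α) ((d - ∑ j ∈ Finset.Iio i, u j) * β₁ + (f - u i) * β₂)

variable {A : Type*} {α β₁ β₂ B : ℕ}

theorem Arrangement.card_surviving (a : Arrangement n d r e f u) :
    (a.lostᶜ).card = n / r - e / f := by
  rw [Finset.card_compl, Fintype.card_fin, a.card_lost]

/-- If the core racks of earlier stages are known before the repair in stage `i`, then the core
racks of stage `i` can be described after the repair by `coreCost` symbols each. -/
theorem Arrangement.describedBy_stage (a : Arrangement n d r e f u) (i : Fin g)
    {c c' : State A n r α B} (hc : Repairs β₁ β₂ c (a.pattern i) c') :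
    DescribedBy A (fun x y => (∀ j < i, ∀ h ∈ a.core j, ∀ v, c h v x = c h v y) →
      ∀ h ∈ a.core i, ∀ v, c' h v x = c' h v y) (u i * coreCost n d r e f α β₁ β₂ u i) := by
  classical
  rw [← a.card_core i]
  rcases le_total (e / f * α)
    ((d - ∑ j ∈ Finset.Iio i, u j) * β₁ + (f - u i) * β₂) with hle | hle
  · have : coreCost n d r e f α β₁ β₂ u i = (Finset.univ : Finset (Fin (n / r))).card * α := by
      have := a.card_lost ▸ Finset.card_le_univ a.lost
      rw [Fintype.card_fin] at this
      rw [coreCost, min_eq_left hle, ← add_mul, Nat.sub_add_cancel this, Finset.card_univ,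
        Fintype.card_fin]
    rw [this]
    exact (DescribedBy.forall_mem_const _ fun h _ => DescribedBy.forall_mem_const _ fun v _ =>
      DescribedBy.of_fun (c' h v)).mono fun x y hxy _ h hh v => hxy h hh v (Finset.mem_univ v)
  · obtain ⟨hkeep, first, second, rebuild, hrep⟩ := hc
    have hcost : coreCost n d r e f α β₁ β₂ u i = (a.lostᶜ).card * α +
        (((a.pattern i).helpers \ (Finset.Iio i).biUnion a.core).card * β₁ +
          ((a.pattern i).racks \ a.core i).card * β₂) := by
      rw [coreCost, min_eq_right hle, a.card_surviving, a.card_new_helpers, a.card_other_racks]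
    rw [hcost]
    let m₁ (j h : Fin r) (x : Fin B → A) : Fin β₁ → A := first j h fun v => c j v x
    let m₂ (h' h : Fin r) (x : Fin B → A) : Fin β₂ → A :=
      second h' h (fun v => c h' v.1 x) (fun j => m₁ j.1 h' x)
    refine (DescribedBy.forall_mem_const (a.core i) fun h _ =>
      (DescribedBy.forall_mem_const _ fun v _ => DescribedBy.of_fun (c h v)).and
      ((DescribedBy.forall_mem_const _ fun j _ => DescribedBy.of_fun (m₁ j h)).and
      (DescribedBy.forall_mem_const _ fun h' _ => DescribedBy.of_fun (m₂ h' h)))).mono ?_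
    intro x y hxy hprev
    have hsurv : ∀ h ∈ a.core i, ∀ v, v ∉ (a.pattern i).failed h → c h v x = c h v y := by
      intro h hh v hv
      rw [a.failed_eq] at hv
      exact (hxy h hh).1 v (Finset.mem_compl.2 hv)
    -- A helper from an earlier core group has known contents, hence its message is known; only the
    -- new helpers are charged.
    have h₁ : ∀ h ∈ a.core i, ∀ j ∈ (a.pattern i).helpers, m₁ j h x = m₁ j h y := by
      intro h hh j hj
      by_cases hj' : j ∈ (Finset.Iio i).biUnion a.core
      · obtain ⟨l, hl, hjl⟩ := Finset.mem_biUnion.1 hj'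
        exact congrArg (first j h) (funext fun v => hprev l (Finset.mem_Iio.1 hl) j hjl v)
      · exact (hxy h hh).2.1 j (Finset.mem_sdiff.2 ⟨hj, hj'⟩)
    -- Second-round messages depend on survivors and first-round messages only. For a sender in the
    -- core both are already determined, so only the `f - u i` other racks are charged.
    have h₂ : ∀ h ∈ a.core i, ∀ h' ∈ (a.pattern i).racks, m₂ h' h x = m₂ h' h y := by
      intro h hh h' hh'
      by_cases hc : h' ∈ a.core i
      · exact congrArg₂ (second h' h) (funext fun v => hsurv h' hc v.1 v.2)
          (funext fun j => h₁ h' hc j.1 j.2)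
      · exact (hxy h hh).2.2 h' (Finset.mem_sdiff.2 ⟨hh', hc⟩)
    intro h hh v
    by_cases hv : v ∈ (a.pattern i).failed h
    · have hx := hrep x h (a.core_subset i hh) v hv
      have hy := hrep y h (a.core_subset i hh) v hv
      dsimp only at hx hy
      rw [hx, hy, show (fun w : {w // w ∉ (a.pattern i).failed h} => c h w.1 x) =
        fun w => c h w.1 y from funext fun w => hsurv h hh w.1 w.2,
        show (fun j : {j // j ∈ (a.pattern i).helpers} => first j.1 h fun v => c j.1 v x) =
        fun j => first j.1 h fun v => c j.1 v y from funext fun j => h₁ h hh j.1 j.2]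
      exact congrFun (congrArg _ (funext
        fun h' : {h' // h' ∈ (a.pattern i).racks ∧ h' ≠ h} => h₂ h hh h'.1 h'.2.1)) v
    · rw [hkeep h v fun hf => hv hf.2]
      exact hsurv h hh v hv

/-- Start from any state and apply `regeneration` stage by stage. Since a core rack is never
repaired again, its description after its own stage stays valid, and it supplies the hypothesis of
`describedBy_stage` for later stages. -/
theorem Arrangement.exists_state (a : Arrangement n d r e f u)
    (S : RCSS A n k d r e f α β₁ β₂ B) (t : ℕ) (ht : t ≤ g) :
    ∃ c ∈ S.states, DescribedBy A
      (fun x y => ∀ i : Fin g, i.val < t → ∀ h ∈ a.core i, ∀ v, c h v x = c h v y)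
      (∑ i : Fin g with i.val < t, u i * coreCost n d r e f α β₁ β₂ u i) := by
  classical
  induction t with
  | zero =>
    obtain ⟨c, hc⟩ := S.nonempty
    refine ⟨c, hc, ?_⟩
    simp only [Nat.not_lt_zero, Finset.filter_false, Finset.sum_empty]
    exact ⟨fun _ i => i.elim0, fun _ _ _ _ h => h.elim⟩
  | succ t ih =>
    obtain ⟨c, hcS, hc⟩ := ih (by omega)
    let s : Fin g := ⟨t, ht⟩
    obtain ⟨c', hcS', hrep⟩ := S.regeneration c hcS (a.pattern s)
    refine ⟨c', hcS', ?_⟩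
    have hfilter : (Finset.univ.filter fun i : Fin g => i.val < t + 1) =
        insert s (Finset.univ.filter fun i : Fin g => i.val < t) := by
      ext i
      simp only [Finset.mem_filter, Finset.mem_univ, true_and, Finset.mem_insert, Fin.ext_iff, s]
      omega
    rw [hfilter, Finset.sum_insert (by simp [s])]
    refine ((a.describedBy_stage s hrep).and hc).mono ?_
    rintro x y ⟨h₁, h₂⟩ i hi h hh v
    rcases Nat.lt_succ_iff_lt_or_eq.1 hi with hlt | heq
    · have hne : i ≠ s := fun h => by simp [h, s] at hlt
      rw [hrep.1 h v fun hf => Finset.disjoint_left.1 (a.disjoint_racks i s hne) hh hf.1]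
      exact h₂ i hlt h hh v
    · obtain rfl : i = s := Fin.ext heq
      exact h₁ (fun j hj => h₂ j hj) h hh v

theorem Arrangement.file_size_le [Finite A] [Nontrivial A] (a : Arrangement n d r e f u)
    (S : RCSS A n k d r e f α β₁ β₂ B) (I : Finset (Fin (n / r))) (hI : ∀ j ∈ I, j.val ≠ 0)
    (hk : (a.collector I).card = k) :
    B ≤ I.card * α + ∑ i, u i * coreCost n d r e f α β₁ β₂ u i := by
  obtain ⟨c, hcS, hc⟩ := a.exists_state S g le_rfl
  obtain ⟨decode, hdec⟩ := S.reconstruction c hcS (a.collector I) hk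
  simp only [Fin.is_lt, Finset.filter_true, true_imp_iff] at hc
  refine ((DescribedBy.forall_mem_const I fun j _ => DescribedBy.of_fun (c a.spare j)).and
    hc).mono ?_ |>.le_of_eq
  rintro x y ⟨h₁, h₂⟩
  rw [← hdec x, ← hdec y]
  congr 1
  funext ⟨⟨h, j⟩, hv⟩
  -- The collector gains nothing beyond its own nodes: the core racks are complete already, and in
  -- the spare rack no relayer is contacted.
  have hcases : (∃ i, h ∈ a.core i) ∨ (h = a.spare ∧ j ∈ I) := by
    rcases hv with hv | ⟨j₀, hj₀, hv⟩
    · exact a.mem_collector.1 hv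
    · rcases a.mem_collector.1 hv with hv | hv
      · exact Or.inl hv
      · exact absurd hj₀ (hI _ hv.2)
  rcases hcases with ⟨i, hi⟩ | ⟨rfl, hj⟩
  · exact h₂ i h hi j
  · exact h₁ j hj

/-! ### The cut and its capacity -/

theorem IFG.version_le {n d r e f : ℕ} (G : IFG n d r e f) (h : Fin r) (t : ℕ) :
    G.version h t ≤ t := by
  induction t with
  | zero => simp [IFG.version]
  | succ t ih =>
    rw [IFG.version]
    split_ifs <;> omega

namespace Arrangement

variable {n d r e f g : ℕ} {u : Fin g → ℕ} (a : Arrangement n d r e f u)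

/-- The information flow graph of an arrangement. -/
abbrev graph : IFG n d r e f := ⟨g, a.pattern⟩

theorem repairedIn_core {i : Fin g} {h : Fin r} (hh : h ∈ a.core i) (s : ℕ) :
    a.graph.RepairedIn s h ↔ s = i.val := by
  constructor
  · rintro ⟨hs, hr⟩
    by_contra hne
    exact Finset.disjoint_left.1
      (a.disjoint_racks i ⟨s, hs⟩ fun h => hne (by rw [h])) hh hr
  · rintro rfl
    exact ⟨i.2, a.core_subset i hh⟩

theorem version_core {i : Fin g} {h : Fin r} (hh : h ∈ a.core i) (t : ℕ) :
    a.graph.version h t = if i.val < t then i.val + 1 else 0 := by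
  induction t with
  | zero => simp [IFG.version]
  | succ t ih =>
    rw [IFG.version, ih]
    simp only [a.repairedIn_core hh]
    split_ifs <;> omega

theorem version_spare (t : ℕ) : a.graph.version a.spare t = 0 := by
  induction t with
  | zero => simp [IFG.version]
  | succ t ih =>
    rw [IFG.version, ih, if_neg]
    rintro ⟨hs, hr⟩
    exact a.spare_notMem _ hr

variable (I : Finset (Fin (n / r))) (op : Fin g → Prop)

open Classical in
/-- The vertices on the sink side of the cut that belong to the core rack `h` of stage `i`. -/
noncomputable def rackSide (i : Fin g) (h : Fin r) : Finset (Vertex g r (n / r)) :=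
  (a.lostᶜ.image (Vertex.out 0 h) ∪ Finset.univ.image (Vertex.out i.succ h)) ∪
    if op i then {Vertex.virt i h, Vertex.mid i h} else ∅

/-- The sink side of the cut: the sink, the nodes of the spare rack with index in `I`, and
the vertices of the core racks; the vertices `virt` and `mid` are included for the stages in `op`. -/
noncomputable def sinkSide : Finset (Vertex g r (n / r)) :=
  insert Vertex.sink (I.image (Vertex.out 0 a.spare) ∪
    Finset.univ.biUnion fun i => (a.core i).biUnion (a.rackSide op i))

theorem source_notMem_sinkSide : Vertex.source ∉ a.sinkSide I op := by
  simp only [sinkSide, rackSide, Finset.mem_insert, Finset.mem_union, Finset.mem_image,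
    Finset.mem_biUnion]
  rintro (h | ⟨_, _, h⟩ | ⟨i, _, h, _, (⟨_, _, h⟩ | ⟨_, _, h⟩) | h⟩) <;> try cases h
  split_ifs at h <;> simp at h

theorem sink_mem_sinkSide : Vertex.sink ∈ a.sinkSide I op := by
  simp [sinkSide]

theorem out_mem_sinkSide {v : Fin (g + 1)} {h : Fin r} {j : Fin (n / r)} :
    Vertex.out v h j ∈ a.sinkSide I op ↔ (v = 0 ∧ h = a.spare ∧ j ∈ I) ∨
      ∃ i, h ∈ a.core i ∧ ((v = 0 ∧ j ∉ a.lost) ∨ v = i.succ) := by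
  have : ∀ i h', Vertex.out v h j ∈ a.rackSide op i h' ↔
      h' = h ∧ ((v = 0 ∧ j ∉ a.lost) ∨ v = i.succ) := by
    intro i h'
    simp only [rackSide, Finset.mem_union, Finset.mem_image, Vertex.out.injEq,
      Finset.mem_compl, Finset.mem_univ, true_and]
    split_ifs <;> simp <;> grind
  simp only [sinkSide, Finset.mem_insert, Finset.mem_union, Finset.mem_image,
    Finset.mem_biUnion, this, reduceCtorEq, false_or, Vertex.out.injEq, Finset.mem_univ, true_and]
  grind

theorem virt_mem_sinkSide {i : Fin g} {h : Fin r} :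
    Vertex.virt i h ∈ a.sinkSide I op ↔ op i ∧ h ∈ a.core i := by
  have : ∀ i' h', Vertex.virt i h ∈ a.rackSide op i' h' ↔ h' = h ∧ i' = i ∧ op i := by
    intro i' h'
    simp only [rackSide, Finset.mem_union, Finset.mem_image, reduceCtorEq, and_false,
      exists_false, false_or]
    split_ifs <;> simp <;> grind
  simp only [sinkSide, Finset.mem_insert, Finset.mem_union, Finset.mem_image,
    Finset.mem_biUnion, this, reduceCtorEq, false_or, Finset.mem_univ, true_and, and_false,
    exists_false]
  grind

theorem mid_mem_sinkSide {i : Fin g} {h : Fin r} :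
    Vertex.mid i h ∈ a.sinkSide I op ↔ op i ∧ h ∈ a.core i := by
  have : ∀ i' h', Vertex.mid i h ∈ a.rackSide op i' h' ↔ h' = h ∧ i' = i ∧ op i := by
    intro i' h'
    simp only [rackSide, Finset.mem_union, Finset.mem_image, reduceCtorEq, and_false,
      exists_false, false_or]
    split_ifs <;> simp <;> grind
  simp only [sinkSide, Finset.mem_insert, Finset.mem_union, Finset.mem_image,
    Finset.mem_biUnion, this, reduceCtorEq, false_or, Finset.mem_univ, true_and, and_false,
    exists_false]
  grind

/-- The total capacity of the edges from the source side of the cut to `y`. -/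
noncomputable def inflow (α β₁ β₂ : ℝ≥0) (y : Vertex g r (n / r)) : ℝ≥0∞ :=
  ∑ x ∈ (a.sinkSide I op)ᶜ, a.graph.cap α β₁ β₂ (a.collector I) x y

variable {I op} {α β₁ β₂ : ℝ≥0}

/-- The infinite edges into the sink start at the final versions of the collected nodes, version `i
+ 1` for core racks and `0` for the spare rack, and these all lie on the sink side. -/
theorem inflow_sink : a.inflow I op α β₁ β₂ Vertex.sink = 0 := by
  refine Finset.sum_eq_zero fun x hx => ?_
  rw [Finset.mem_compl] at hx
  cases x with
  | out v h j =>
    simp only [IFG.cap]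
    rw [if_neg]
    rintro ⟨hK, hv⟩
    refine hx ((a.out_mem_sinkSide I op).2 ?_)
    rcases a.mem_collector.1 hK with ⟨i, hi⟩ | ⟨rfl, hj⟩
    · rw [a.version_core hi, if_pos i.2] at hv
      exact Or.inr ⟨i, hi, Or.inr (Fin.ext hv)⟩
    · rw [a.version_spare] at hv
      exact Or.inl ⟨Fin.ext hv, rfl, hj⟩
  | _ => rfl

/-- The hypothesis guards against the infinite edges into a relayer from other nodes of its rack.
Without them only the edge from the source is cut. -/
theorem inflow_out_zero {h : Fin r} {j : Fin (n / r)}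
    (hj : j.val = 0 → ∀ j', Vertex.out 0 h j' ∈ a.sinkSide I op) :
    a.inflow I op α β₁ β₂ (Vertex.out 0 h j) = α := by
  rw [inflow, Finset.sum_eq_single Vertex.source]
  · simp [IFG.cap]
  · intro x hx hne
    rw [Finset.mem_compl] at hx
    cases x with
    | source => exact absurd rfl hne
    | out v h' j' =>
      simp only [IFG.cap]
      rw [if_neg, if_neg]
      · rintro ⟨-, -, s, hs, -⟩
        simp at hs
      · rintro ⟨rfl, rfl, -, -, h0⟩
        exact hx (hj h0 j')
    | mid s h' =>
      simp only [IFG.cap]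
      rw [if_neg]
      rintro ⟨-, hs, -⟩
      simp at hs
    | _ => rfl
  · intro h
    exact absurd (Finset.mem_compl.2 (a.source_notMem_sinkSide I op)) h

-- Survivors and relayers receive infinite edges only from the sink side. What remains is the edge
-- from `mid` to each lost node, which is cut unless `mid` is on the sink side too.
open Classical in
theorem inflow_out_succ {i : Fin g} {h : Fin r} (hh : h ∈ a.core i) (j : Fin (n / r)) :
    a.inflow I op α β₁ β₂ (Vertex.out i.succ h j) =
      if j ∈ a.lost ∧ ¬ op i then (α : ℝ≥0∞) else 0 := by
  have key : ∀ x ∈ (a.sinkSide I op)ᶜ, x ≠ Vertex.mid i h →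
      a.graph.cap α β₁ β₂ (a.collector I) x (Vertex.out i.succ h j) = 0 := by
    intro x hx hne
    rw [Finset.mem_compl] at hx
    cases x with
    | source => simp [IFG.cap]
    | out v h' j' =>
      simp only [IFG.cap]
      rw [if_neg, if_neg]
      · rintro ⟨rfl, rfl, s, hs, hv, -, hj⟩
        obtain rfl : s = i := Fin.ext (by simpa using hs.symm)
        rw [a.version_core hh, if_neg (lt_irrefl _)] at hv
        rw [a.failed_eq] at hj
        exact hx ((a.out_mem_sinkSide I op).2 (Or.inr ⟨s, hh, Or.inl ⟨Fin.ext hv, hj⟩⟩))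
      · rintro ⟨rfl, rfl, -⟩
        exact hx ((a.out_mem_sinkSide I op).2 (Or.inr ⟨i, hh, Or.inr rfl⟩))
    | mid s h' =>
      simp only [IFG.cap]
      rw [if_neg]
      rintro ⟨rfl, hs, -⟩
      exact hne (by rw [show s = i from Fin.ext (by simpa using hs.symm)])
    | _ => rfl
  by_cases hi : op i
  · rw [if_neg fun h => h.2 hi]
    refine Finset.sum_eq_zero fun x hx => key x hx ?_
    rintro rfl
    exact Finset.mem_compl.1 hx ((a.mid_mem_sinkSide I op).2 ⟨hi, hh⟩)
  · rw [inflow, Finset.sum_eq_single (Vertex.mid i h) key]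
    · simp [IFG.cap, a.core_subset i hh, a.failed_eq, hi]
    · intro h'
      exact absurd (Finset.mem_compl.2 fun h' =>
        hi ((a.mid_mem_sinkSide I op).1 h').1) h'

/-- The vertices `virt` of all core racks of the stage are on the sink side, which covers the
infinite edge as well; each other rack of the group contributes `β₂`. -/
theorem inflow_mid {i : Fin g} {h : Fin r} (hh : h ∈ a.core i) (hi : op i) :
    a.inflow I op α β₁ β₂ (Vertex.mid i h) = ((f - u i : ℕ) : ℝ≥0∞) * β₂ := by
  classical
  have hinj : Function.Injective (Vertex.virt (g := g) (r := r) (N := n / r) i) :=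
    fun _ _ h => by simpa using h
  rw [inflow, ← Finset.sum_subset
    (s₁ := ((a.pattern i).racks \ a.core i).image (Vertex.virt i)),
    Finset.sum_image fun _ _ _ _ h => hinj h]
  · rw [← a.card_other_racks i, ← nsmul_eq_mul]
    refine Finset.sum_eq_card_nsmul fun h' hh' => ?_
    rw [Finset.mem_sdiff] at hh'
    have : h' ≠ h := fun e => hh'.2 (e ▸ hh)
    simp [IFG.cap, a.core_subset i hh, hh'.1, this]
  · intro x hx
    obtain ⟨h', hh', rfl⟩ := Finset.mem_image.1 hx
    rw [Finset.mem_compl, a.virt_mem_sinkSide]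
    exact fun hc => (Finset.mem_sdiff.1 hh').2 hc.2
  · intro x hx hx'
    rw [Finset.mem_compl] at hx
    cases x with
    | virt s h' =>
      simp only [IFG.cap]
      rw [if_neg]
      rintro ⟨rfl, hr, -⟩
      refine hx' (Finset.mem_image.2 ⟨h', Finset.mem_sdiff.2 ⟨hr, fun hc => hx ?_⟩, rfl⟩)
      exact (a.virt_mem_sinkSide I op).2 ⟨hi, hc⟩
    | _ => rfl

theorem inflow_virt (hI : ∀ j ∈ I, j.val ≠ 0) (hlost : a.lost.Nonempty) {i : Fin g} {h : Fin r}
    (hh : h ∈ a.core i) :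
    a.inflow I op α β₁ β₂ (Vertex.virt i h) =
      ((d - ∑ j ∈ Finset.Iio i, u j : ℕ) : ℝ≥0∞) * β₁ := by
  classical
  obtain ⟨l, hl⟩ := hlost
  let z : Fin (n / r) := ⟨0, l.pos⟩
  have hz : z ∈ a.lost := a.relayer_lost ⟨l, hl⟩ z rfl
  let rel (j : Fin r) : Vertex g r (n / r) := Vertex.out
    ⟨a.graph.version j i, (a.graph.version_le j i).trans_lt (by omega)⟩ j z
  have hinj : Function.Injective rel := fun _ _ h => by
    simp only [rel, Vertex.out.injEq] at h
    exact h.2.1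
  rw [inflow, ← Finset.sum_subset
    (s₁ := ((a.pattern i).helpers \ (Finset.Iio i).biUnion a.core).image rel),
    Finset.sum_image fun _ _ _ _ h => hinj h]
  · rw [← a.card_new_helpers i, ← nsmul_eq_mul]
    refine Finset.sum_eq_card_nsmul fun j hj => ?_
    rw [Finset.mem_sdiff] at hj
    have : j ≠ h := fun e => Finset.disjoint_left.1 (a.pattern i).disjoint_helpers hj.1
      (e ▸ a.core_subset i hh)
    simp [rel, z, IFG.cap, a.core_subset i hh, hj.1, this]
  · intro x hx
    obtain ⟨j, hj, rfl⟩ := Finset.mem_image.1 hx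
    rw [Finset.mem_compl, a.out_mem_sinkSide]
    -- The current relayer of a new helper is on the source side: `I` contains no relayer, relayers
    -- of core racks at version `0` are lost, and version `i' + 1` is current only for `i' < i`,
    -- that is, for earlier core racks.
    rintro (⟨-, -, hc⟩ | ⟨i', hi', hc⟩)
    · exact hI z hc rfl
    · rcases hc with hc | hc
      · exact hc.2 hz
      · have hv := congrArg Fin.val hc
        simp only [a.version_core hi', Fin.val_succ] at hv
        split_ifs at hv with hlt
        · exact (Finset.mem_sdiff.1 hj).2 (Finset.mem_biUnion.2 ⟨i', Finset.mem_Iio.2 hlt, hi'⟩)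
  · intro x hx hx'
    rw [Finset.mem_compl] at hx
    cases x with
    | out v j k =>
      simp only [IFG.cap]
      split_ifs with h1 h2 h3 h4
      · rfl
      · subst h2
        rw [a.failed_eq] at h3
        have hv := h1.2
        rw [a.version_core hh, if_neg (lt_irrefl _)] at hv
        exact absurd ((a.out_mem_sinkSide I op).2 (Or.inr ⟨i, hh, Or.inl ⟨Fin.ext hv, h3⟩⟩)) hx
      · by_cases hj : j ∈ (Finset.Iio i).biUnion a.core
        · obtain ⟨i', hi', hj⟩ := Finset.mem_biUnion.1 hj
          have hv := h1.2
          rw [a.version_core hj, if_pos (Fin.lt_def.1 (Finset.mem_Iio.1 hi'))] at hv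
          exact absurd ((a.out_mem_sinkSide I op).2 (Or.inr ⟨i', hj, Or.inr (Fin.ext hv)⟩)) hx
        · refine absurd (Finset.mem_image.2 ⟨j, Finset.mem_sdiff.2 ⟨h4.1, hj⟩, ?_⟩) hx'
          simp only [rel, Vertex.out.injEq, true_and]
          exact ⟨Fin.ext h1.2.symm, Fin.ext h4.2.symm⟩
      · rfl
      · rfl
    | _ => rfl

/-- The capacity of the edges that enter the part of a core rack on the sink side. -/
theorem sum_rackSide (hI : ∀ j ∈ I, j.val ≠ 0) {i : Fin g} {h : Fin r}
    (hh : h ∈ a.core i) (hop : op i → a.lost.Nonempty) [Decidable (op i)] :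
    ∑ y ∈ a.rackSide op i h, a.inflow I op α β₁ β₂ y =
      ((n / r - e / f : ℕ) : ℝ≥0∞) * α + if op i then
        ((d - ∑ j ∈ Finset.Iio i, u j : ℕ) : ℝ≥0∞) * β₁ + ((f - u i : ℕ) : ℝ≥0∞) * β₂
      else ((e / f : ℕ) : ℝ≥0∞) * α := by
  classical
  have h0 : ∑ y ∈ a.lostᶜ.image (Vertex.out 0 h), a.inflow I op α β₁ β₂ y =
      ((n / r - e / f : ℕ) : ℝ≥0∞) * α := by
    rw [Finset.sum_image fun _ _ _ _ h => by simpa using h, ← a.card_surviving, ← nsmul_eq_mul]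
    refine Finset.sum_eq_card_nsmul fun j hj => a.inflow_out_zero fun hj0 j' => ?_
    refine (a.out_mem_sinkSide I op).2 (Or.inr ⟨i, hh, Or.inl ⟨rfl, fun hj' => ?_⟩⟩)
    -- A relayer can survive only if nothing is lost, and then the whole initial version of the rack
    -- is on the sink side.
    exact Finset.mem_compl.1 hj (a.relayer_lost ⟨j', hj'⟩ j hj0)
  have h1 : ∑ y ∈ Finset.univ.image (Vertex.out i.succ h), a.inflow I op α β₁ β₂ y =
      if op i then 0 else ((e / f : ℕ) : ℝ≥0∞) * α := by
    rw [Finset.sum_image fun _ _ _ _ h => by simpa using h]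
    simp only [a.inflow_out_succ hh]
    split_ifs with hi
    · simp [hi]
    · simp [hi, ← a.card_lost]
  rw [rackSide, Finset.sum_union, Finset.sum_union, h0, h1, add_assoc]
  · congr 1
    split_ifs with hi
    · rw [Finset.sum_pair (by simp), zero_add, a.inflow_virt hI (hop hi) hh, a.inflow_mid hh hi]
    · simp
  · rw [Finset.disjoint_left]
    intro x hx hx'
    obtain ⟨j, -, rfl⟩ := Finset.mem_image.1 hx
    simp [Fin.succ_ne_zero] at hx'
  · rw [Finset.disjoint_left]
    intro x hx
    split_ifs
    · cases x <;> simp at hx ⊢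
    · simp

theorem cutCapacity_sinkSide (hI : ∀ j ∈ I, j.val ≠ 0) (hop : ∀ i, op i → a.lost.Nonempty)
    [DecidablePred op] :
    a.graph.cutCapacity α β₁ β₂ (a.collector I) (a.sinkSide I op) =
      (I.card : ℝ≥0∞) * α + ∑ i, (u i : ℝ≥0∞) * (((n / r - e / f : ℕ) : ℝ≥0∞) * α + if op i then
        ((d - ∑ j ∈ Finset.Iio i, u j : ℕ) : ℝ≥0∞) * β₁ + ((f - u i : ℕ) : ℝ≥0∞) * β₂
      else ((e / f : ℕ) : ℝ≥0∞) * α) := by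
  classical
  have hrack : ∀ i h x, x ∈ a.rackSide op i h →
      (∃ v j, x = Vertex.out v h j) ∨ x = Vertex.virt i h ∨ x = Vertex.mid i h := by
    intro i h x hx
    simp only [rackSide, Finset.mem_union, Finset.mem_image] at hx
    rcases hx with (⟨j, -, rfl⟩ | ⟨j, -, rfl⟩) | hx
    · exact Or.inl ⟨_, _, rfl⟩
    · exact Or.inl ⟨_, _, rfl⟩
    · split_ifs at hx
      · exact Or.inr (by simpa using hx)
      · simp at hx
  have hdisj : ∀ i i' h h', h ≠ h' → Disjoint (a.rackSide op i h) (a.rackSide op i' h') := by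
    intro i i' h h' hne
    rw [Finset.disjoint_left]
    intro x hx hx'
    rcases hrack i h x hx with ⟨v, j, rfl⟩ | rfl | rfl <;>
      rcases hrack i' h' _ hx' with ⟨v', j', he⟩ | he | he <;> simp_all
  -- Exchanging the sums groups the cut edges by their heads.
  have hcut : a.graph.cutCapacity α β₁ β₂ (a.collector I) (a.sinkSide I op) =
      ∑ y ∈ a.sinkSide I op, a.inflow I op α β₁ β₂ y := Finset.sum_comm
  rw [hcut, sinkSide, Finset.sum_insert, a.inflow_sink, zero_add, Finset.sum_union]
  · congr 1
    · rw [Finset.sum_image fun _ _ _ _ h => by simpa using h, ← nsmul_eq_mul]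
      exact Finset.sum_eq_card_nsmul fun j hj => a.inflow_out_zero fun hj0 => absurd hj0 (hI j hj)
    · rw [Finset.sum_biUnion]
      · refine Finset.sum_congr rfl fun i _ => ?_
        rw [Finset.sum_biUnion fun h _ h' _ hne => hdisj i i h h' hne, ← a.card_core i,
          ← nsmul_eq_mul]
        exact Finset.sum_eq_card_nsmul fun h hh => a.card_core i ▸ a.sum_rackSide hI hh (hop i)
      · intro i _ i' _ hne
        simp only [Function.onFun, Finset.disjoint_biUnion_left, Finset.disjoint_biUnion_right]
        exact fun h hh h' hh' => hdisj _ _ _ _ fun he =>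
          Finset.disjoint_left.1 (a.disjoint_core i i' hne) hh' (he ▸ hh)
  · simp only [Finset.disjoint_biUnion_right]
    intro i _ h hh
    rw [Finset.disjoint_left]
    intro x hx hx'
    obtain ⟨j, -, rfl⟩ := Finset.mem_image.1 hx
    rcases hrack i h _ hx' with ⟨v, j', he⟩ | he | he
    · simp only [Vertex.out.injEq] at he
      exact a.spare_notMem_core i (he.2.1 ▸ hh)
    · cases he
    · cases he
  · simp only [Finset.mem_union, Finset.mem_image, Finset.mem_biUnion, reduceCtorEq, and_false,
      exists_false, false_or, not_exists, not_and]
    intro i _ h _ hx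
    rcases hrack i h _ hx with ⟨v, j', he⟩ | he | he <;> cases he

end Arrangement

/-! ### Rewriting the bound and conclusion -/

/-- With `q = e / f`, this is `q * α + min 0 (X - q * α) = min (q * α) X` in each summand, while `k
* α` is distributed as `k₀ * α + ∑ i, u i * (N * α)`. The hypotheses make every natural subtraction
a true one. -/
theorem fileSizeBound_eq {k d e f N m k₀ : ℕ} (hf : 0 < f) (hfe : f ∣ e) (hq : e / f ≤ N)
    (hk : k = m * N + k₀) (hmd : m ≤ d) {g : ℕ} {u : Fin g → ℕ} (hu : ∀ i, u i ≤ f)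
    (hum : ∑ i, u i = m) (α β₁ β₂ : ℝ) :
    fileSizeBound k d e f α β₁ β₂ u = k₀ * α + ∑ i, (u i : ℝ) * (((N - e / f : ℕ) : ℝ) * α +
      min (((e / f : ℕ) : ℝ) * α) (((d - ∑ j ∈ Finset.Iio i, u j : ℕ) : ℝ) * β₁ +
        ((f - u i : ℕ) : ℝ) * β₂)) := by
  have hterm : ∀ i, (u i : ℝ) * (((N - e / f : ℕ) : ℝ) * α +
      min (((e / f : ℕ) : ℝ) * α) (((d - ∑ j ∈ Finset.Iio i, u j : ℕ) : ℝ) * β₁ +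
        ((f - u i : ℕ) : ℝ) * β₂)) = (u i : ℝ) * (N * α) + (u i : ℝ) *
    min 0 (((d : ℝ) - ∑ j ∈ Finset.Iio i, (u j : ℝ)) * β₁ - ((e : ℝ) / (f : ℝ)) * α
      + ((f : ℝ) - (u i : ℝ)) * β₂) := by
    intro i
    have hs : ∑ j ∈ Finset.Iio i, u j ≤ d :=
      (Finset.sum_le_sum_of_subset (Finset.subset_univ _)).trans (hum.trans_le hmd)
    rw [Nat.cast_sub hq, Nat.cast_sub hs, Nat.cast_sub (hu i), Nat.cast_sum,
      Nat.cast_div hfe (by positivity), ← mul_add]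
    congr 1
    rw [min_def, min_def]
    split_ifs <;> first | ring1 | (exfalso; linarith)
  simp only [hterm]
  rw [Finset.sum_add_distrib, ← Finset.sum_mul, ← Nat.cast_sum, hum, fileSizeBound, hk]
  push_cast
  ring

end RackCoop

theorem theorem1 (n k d r e f : ℕ) (hn : 0 < n) (hrn : r ∣ n) (hkn : k ≤ n)
    (hf : 0 < f) (hfe : f ∣ e) (hef : e / f ≤ n / r)
    (hmd : k * r / n ≤ d) (hdr : d + f ≤ r) (hfm : f ∣ k * r / n) :
    (∀ (A : Type*) [Finite A] [Nontrivial A] (α β₁ β₂ B : ℕ),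
      Nonempty (RackCoop.RCSS A n k d r e f α β₁ β₂ B) →
      ∀ (g : ℕ) (u : Fin g → ℕ), (∀ i, 1 ≤ u i ∧ u i ≤ f) → ∑ i, u i = k * r / n →
        (B : ℝ) ≤ RackCoop.fileSizeBound k d e f α β₁ β₂ u) ∧
    (∀ (α β₁ β₂ : NNReal) (g : ℕ) (u : Fin g → ℕ),
      (∀ i, 1 ≤ u i ∧ u i ≤ f) → ∑ i, u i = k * r / n →
        ∃ (G : RackCoop.IFG n d r e f) (K : Finset (Fin r × Fin (n / r)))
          (W : Finset (RackCoop.Vertex G.numStages r (n / r))),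
          K.card = k ∧ RackCoop.Vertex.source ∉ W ∧ RackCoop.Vertex.sink ∈ W ∧
          G.cutCapacity α β₁ β₂ K W ≠ ⊤ ∧
          (G.cutCapacity α β₁ β₂ K W).toReal = RackCoop.fileSizeBound k d e f α β₁ β₂ u) := by
  classical
  have hr : 0 < r := by omega
  have hN : 0 < n / r := Nat.div_pos (Nat.le_of_dvd hn hrn) hr
  have hm : k * r / n = k / (n / r) := by
    conv_lhs => rw [← Nat.div_mul_cancel hrn]
    exact Nat.mul_div_mul_right _ _ hr
  have hk : k = k * r / n * (n / r) + k % (n / r) := by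
    rw [hm, mul_comm]; exact (Nat.div_add_mod _ _).symm
  obtain ⟨I, hI, hIc⟩ : ∃ I : Finset (Fin (n / r)),
      (∀ j ∈ I, j.val ≠ 0) ∧ I.card = k % (n / r) := by
    obtain ⟨I, hI, hIc⟩ := Finset.exists_subset_card_eq
      (s := Finset.univ.erase (⟨0, hN⟩ : Fin (n / r))) (n := k % (n / r)) (by
        rw [Finset.card_erase_of_mem (Finset.mem_univ _), Finset.card_univ, Fintype.card_fin]
        have := Nat.mod_lt k hN
        omega)
    exact ⟨I, fun j hj h0 => (Finset.mem_erase.1 (hI hj)).1 (Fin.ext h0), hIc⟩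
  constructor
  · rintro A _ _ α β₁ β₂ B ⟨S⟩ g u hu hum
    obtain ⟨a⟩ := RackCoop.Arrangement.nonempty hef hu (hum.trans_le hmd) hdr hf
    rw [RackCoop.fileSizeBound_eq hf hfe hef hk hmd (fun i => (hu i).2) hum]
    have hcard : (a.collector I).card = k := by rw [a.card_collector, hum, hIc]; exact hk.symm
    have := a.file_size_le S I hI hcard
    simp only [RackCoop.coreCost, hIc] at this
    exact_mod_cast this
  · intro α β₁ β₂ g u hu hum
    obtain ⟨a⟩ := RackCoop.Arrangement.nonempty hef hu (hum.trans_le hmd) hdr hf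
    have hcard : (a.collector I).card = k := by rw [a.card_collector, hum, hIc]; exact hk.symm
    -- The inequality is strict so that `op i` fails when `e / f = 0`; then `op i` ensures that the
    -- relayer is lost, as `inflow_virt` requires.
    let op : Fin g → Prop := fun i => ((d - ∑ j ∈ Finset.Iio i, u j : ℕ) : ℝ≥0) * β₁ +
      ((f - u i : ℕ) : ℝ≥0) * β₂ < ((e / f : ℕ) : ℝ≥0) * α
    have hop : ∀ i, op i → a.lost.Nonempty := by
      intro i hi
      rw [← Finset.card_pos, a.card_lost]
      by_contra h0
      simp [op, Nat.eq_zero_of_not_pos h0] at hi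
    have hcut : a.graph.cutCapacity α β₁ β₂ (a.collector I) (a.sinkSide I op) =
        (((k % (n / r) : ℕ) * α + ∑ i, (u i : ℝ≥0) * (((n / r - e / f : ℕ) : ℝ≥0) * α +
          min (((e / f : ℕ) : ℝ≥0) * α) (((d - ∑ j ∈ Finset.Iio i, u j : ℕ) : ℝ≥0) * β₁ +
          ((f - u i : ℕ) : ℝ≥0) * β₂)) : ℝ≥0) : ℝ≥0∞) := by
      rw [a.cutCapacity_sinkSide hI hop, hIc, ENNReal.coe_add, ENNReal.ofNNReal_finsetSum]
      congr 1
      refine Finset.sum_congr rfl fun i _ => ?_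
      by_cases hi : op i
      · rw [if_pos hi, min_eq_right hi.le]
        simp only [ENNReal.coe_add, ENNReal.coe_mul, ENNReal.coe_natCast]
      · rw [if_neg hi, min_eq_left (not_lt.1 hi)]
        simp only [ENNReal.coe_add, ENNReal.coe_mul, ENNReal.coe_natCast]
    refine ⟨a.graph, a.collector I, a.sinkSide I op, hcard, a.source_notMem_sinkSide I op,
      a.sink_mem_sinkSide I op, hcut ▸ ENNReal.coe_ne_top, ?_⟩
    rw [hcut, RackCoop.fileSizeBound_eq hf hfe hef hk hmd (fun i => (hu i).2) hum,
      ENNReal.coe_toReal]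
    simp only [NNReal.coe_add, NNReal.coe_mul, NNReal.coe_natCast, NNReal.coe_min,
      NNReal.coe_sum]
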